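/- Let $X$ be a complex Banach space and $T$ a bounded linear operator on $X$, with dual operator $T^*$ on $X^*$. Conventions. For a bounded operator $S$ on a Banach space put $\alpha(S)=\dim\ker S$ and $\beta(S)=\operatorname{codim}\operatorname{ran}S$, and let the ascent $p(S)$ (resp. descent $q(S)$) be the least $n\ge 0$ with $\ker S^n=\ker S^{n+1}$ (resp. $\operatorname{ran}S^n=\operatorname{ran}S^{n+1}$), or $\infty$ if there is none. $S$ is upper semi-Fredholm if $\alpha(S)<\infty$ and $\operatorname{ran}S$ is closed, lower semi-Fredholm if $\beta(S)<\infty$, semi-Fredholm if it is one of the two, and Fredholm if it is both; the index of a semi-Fredholm operator is $\operatorname{ind}(S)=\alpha(S)-\beta(S)\in\mathbb Z\cup\{\pm\infty\}$. $S$ is upper semi-Browder if it is upper semi-Fredholm with $p(S)<\infty$, lower semi-Browder if it is lower semi-Fredholm with $q(S)<\infty$, and Browder if it is Fredholm with $p(S)<\infty$ and $q(S)<\infty$. $S$ is zeroloid if its spectrum has no accumulation point other than possibly $0$. $S$ has the SVEP at $0$ if, for every connected open neighbourhood $U$ of $0$, the only analytic function $f$ on $U$ with $(S-\mu I)f(\mu)=0$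 for all $\mu\in U$ is $f=0$. $T$ is upper semi-$g_z$-Fredholm (resp. lower semi-$g_z$-Fredholm, $g_z$-Fredholm, upper semi-$g_z$-Browder, lower semi-$g_z$-Browder, $g_z$-Browder) if there are closed $T$-invariant subspaces $M,N$ with $X=M\oplus N$ such that the restriction $T_M$ is upper semi-Fredholm (resp. lower semi-Fredholm, Fredholm, upper semi-Browder, lower semi-Browder, Browder) and the restriction $T_N$ is zeroloid. If $T$ is upper or lower semi-$g_z$-Fredholm, its index $\operatorname{ind}(T)$ is $\operatorname{ind}(T_M)$ for any such pair $(M,N)$ with $T_M$ semi-Fredholm and $T_N$ zeroloid (it does not depend on the pair). $T$ is upper semi-$g_z$-Weyl (resp. lower semi-$g_z$-Weyl, $g_z$-Weyl) if it is upper semi-$g_z$-Fredholm with $\operatorname{ind}(T)\le 0$ (resp. lower semi-$g_z$-Fredholm with $\operatorname{ind}(T)\ge 0$, $g_z$-Fredholm with $\operatorname{ind}(T)=0$). Proposition. (1) The following are equivalent: (i) $T$ is upper semi-$g_z$-Browder; (ii) $T$ is upper semi-$g_z$-Weyl and $T$ has the SVEP at $0$; (iii) $T$ is upper semi-$g_z$-Fredholm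 and $T$ has the SVEP at $0$. (2) The following are equivalent: (i) $T$ is lower semi-$g_z$-Browder; (ii) $T$ is lower semi-$g_z$-Weyl and $T^*$ has the SVEP at $0$; (iii) $T$ is lower semi-$g_z$-Fredholm and $T^*$ has the SVEP at $0$. (3) The following are equivalent: (i) $T$ is $g_z$-Browder; (ii) $T$ is $g_z$-Weyl and $T$ or $T^*$ has the SVEP at $0$; (iii) $T$ is $g_z$-Fredholm and $T\oplus T^*$ has the SVEP at $0$. -/

import Mathlib

open Topology

noncomputable section

namespace GzTheory

section Basic

variable {Y : Type*} [NormedAddCommGroup Y] [NormedSpace ℂ Y]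

/-- `α(T)`: the dimension of the kernel of `T`, as an extended natural number. -/
def nullity (T : Y →L[ℂ] Y) : ℕ∞ := Cardinal.toENat (Module.rank ℂ T.ker)

/-- `β(T)`: the codimension of the range of `T`, as an extended natural number. -/
def deficiency (T : Y →L[ℂ] Y) : ℕ∞ := Cardinal.toENat (Module.rank ℂ (Y ⧸ T.range))

/-- `p(T)`: the least `n` with `ker Tⁿ = ker Tⁿ⁺¹`, and `∞` if there is none. -/
def ascent (T : Y →L[ℂ] Y) : ℕ∞ :=
  sInf ((fun n : ℕ => (n : ℕ∞)) '' {n : ℕ | (T ^ n).ker = (T ^ (n + 1)).ker})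

/-- `q(T)`: the least `n` with `range Tⁿ = range Tⁿ⁺¹`, and `∞` if there is none. -/
def descent (T : Y →L[ℂ] Y) : ℕ∞ :=
  sInf ((fun n : ℕ => (n : ℕ∞)) '' {n : ℕ | (T ^ n).range = (T ^ (n + 1)).range})

/-- Upper semi-Fredholm: finite-dimensional kernel and closed range. -/
def IsUpperSemiFredholm (T : Y →L[ℂ] Y) : Prop :=
  nullity T < ⊤ ∧ IsClosed (T.range : Set Y)

/-- Lower semi-Fredholm: range of finite codimension (on a Banach space the range is then
automatically closed). -/
def IsLowerSemiFredholm (T : Y →L[ℂ] Y) : Prop :=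
  deficiency T < ⊤

/-- Semi-Fredholm: upper or lower semi-Fredholm. -/
def IsSemiFredholm (T : Y →L[ℂ] Y) : Prop :=
  IsUpperSemiFredholm T ∨ IsLowerSemiFredholm T

/-- The index `α(T) - β(T)` of a semi-Fredholm operator, an integer or `±∞`. It is only used for
semi-Fredholm operators, for which the difference is not of the form `∞ - ∞`. -/
def index (T : Y →L[ℂ] Y) : EReal :=
  (((nullity T : ℕ∞) : ENNReal) : EReal) - (((deficiency T : ℕ∞) : ENNReal) : EReal)

/-- Upper semi-Browder: upper semi-Fredholm with finite ascent. -/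
def IsUpperSemiBrowder (T : Y →L[ℂ] Y) : Prop :=
  IsUpperSemiFredholm T ∧ ascent T < ⊤

/-- Lower semi-Browder: lower semi-Fredholm with finite descent. -/
def IsLowerSemiBrowder (T : Y →L[ℂ] Y) : Prop :=
  IsLowerSemiFredholm T ∧ descent T < ⊤

/-- Browder: Fredholm with finite ascent and finite descent. -/
def IsBrowder (T : Y →L[ℂ] Y) : Prop :=
  T.IsFredholm ∧ ascent T < ⊤ ∧ descent T < ⊤

/-- Zeroloid: the spectrum has no accumulation point other than (possibly) `0`. -/
def IsZeroloid (T : Y →L[ℂ] Y) : Prop :=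
  derivedSet (spectrum ℂ T) ⊆ {0}

/-- The single-valued extension property of `T` at `z`: on every connected open neighbourhood `U`
of `z`, the only analytic solution `f : U → Y` of `(T - μ I) f(μ) = 0` is `f = 0`. -/
def HasSVEPAt (T : Y →L[ℂ] Y) (z : ℂ) : Prop :=
  ∀ U : Set ℂ, IsOpen U → IsPreconnected U → z ∈ U →
    ∀ f : ℂ → Y, AnalyticOnNhd ℂ f U →
      (∀ μ ∈ U, (T - μ • ContinuousLinearMap.id ℂ Y) (f μ) = 0) → ∀ μ ∈ U, f μ = 0

/-- The dual operator `T* : Y* → Y*`, `φ ↦ φ ∘ T`, on the (Banach) dual of `Y`. -/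
def dualOp (T : Y →L[ℂ] Y) : StrongDual ℂ Y →L[ℂ] StrongDual ℂ Y :=
  ContinuousLinearMap.precomp ℂ T

theorem nullity_lt_top_iff (T : Y →L[ℂ] Y) : nullity T < ⊤ ↔ FiniteDimensional ℂ T.ker := by
  rw [nullity, Cardinal.toENat_lt_top, Module.rank_lt_aleph0_iff]

theorem deficiency_lt_top_iff (T : Y →L[ℂ] Y) :
    deficiency T < ⊤ ↔ FiniteDimensional ℂ (Y ⧸ T.range) := by
  rw [deficiency, Cardinal.toENat_lt_top, Module.rank_lt_aleph0_iff]

/-- On a Banach space, Fredholm means upper and lower semi-Fredholm. -/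
theorem isFredholm_iff [CompleteSpace Y] (T : Y →L[ℂ] Y) :
    T.IsFredholm ↔ IsUpperSemiFredholm T ∧ IsLowerSemiFredholm T := by
  rw [IsUpperSemiFredholm, IsLowerSemiFredholm, nullity_lt_top_iff, deficiency_lt_top_iff]
  constructor
  · intro h
    exact ⟨⟨h.finite_ker, h.isClosed_range⟩, h.finite_coker⟩
  · rintro ⟨⟨h1, h2⟩, h3⟩
    refine ⟨?_, h2, h1, h3, Submodule.ClosedComplemented.of_finiteDimensional _⟩
    have : CompleteSpace T.range := h2.completeSpace_coe
    have ho : IsOpenMap T.rangeRestrict :=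
      T.rangeRestrict.isOpenMap (LinearMap.surjective_rangeRestrict T.toLinearMap)
    have hq : IsQuotientMap (Set.rangeFactorization T) :=
      ho.isQuotientMap T.rangeRestrict.continuous
        (LinearMap.surjective_rangeRestrict T.toLinearMap)
    exact Topology.isStrictMap_iff_isQuotientMap_rangeFactorization.2 hq

end Basic

section Reduction

variable {X : Type*} [NormedAddCommGroup X] [NormedSpace ℂ X]

/-- `(M, N) ∈ Red(T)`: closed `T`-invariant subspaces `M`, `N` with `X = M ⊕ N`. -/
structure Red (T : X →L[ℂ] X) where
  M : Submodule ℂ X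
  N : Submodule ℂ X
  isClosed_M : IsClosed (M : Set X)
  isClosed_N : IsClosed (N : Set X)
  invariant_M : ∀ x ∈ M, T x ∈ M
  invariant_N : ∀ x ∈ N, T x ∈ N
  isCompl : IsCompl M N

/-- The restriction `T_M : M → M`. -/
def Red.onM {T : X →L[ℂ] X} (D : Red T) : D.M →L[ℂ] D.M := T.restrict D.invariant_M

/-- The restriction `T_N : N → N`. -/
def Red.onN {T : X →L[ℂ] X} (D : Red T) : D.N →L[ℂ] D.N := T.restrict D.invariant_N

/-- Upper semi-`g_z`-Fredholm. -/
def IsUpperSemiGzFredholm (T : X →L[ℂ] X) : Prop :=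
  ∃ D : Red T, IsUpperSemiFredholm D.onM ∧ IsZeroloid D.onN

/-- Lower semi-`g_z`-Fredholm. -/
def IsLowerSemiGzFredholm (T : X →L[ℂ] X) : Prop :=
  ∃ D : Red T, IsLowerSemiFredholm D.onM ∧ IsZeroloid D.onN

/-- `g_z`-Fredholm. -/
def IsGzFredholm (T : X →L[ℂ] X) : Prop :=
  ∃ D : Red T, D.onM.IsFredholm ∧ IsZeroloid D.onN

open Classical in
/-- The index of a semi-`g_z`-Fredholm operator `T`: the index of `T_M` for any `(M, N) ∈ Red(T)`
with `T_M` semi-Fredholm and `T_N` zeroloid (it does not depend on the pair; one is chosen here).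
The value `0` for other operators is never used. -/
def gzIndex (T : X →L[ℂ] X) : EReal :=
  if h : ∃ D : Red T, IsSemiFredholm D.onM ∧ IsZeroloid D.onN then index h.choose.onM else 0

/-- Upper semi-`g_z`-Weyl. -/
def IsUpperSemiGzWeyl (T : X →L[ℂ] X) : Prop :=
  IsUpperSemiGzFredholm T ∧ gzIndex T ≤ 0

/-- Lower semi-`g_z`-Weyl. -/
def IsLowerSemiGzWeyl (T : X →L[ℂ] X) : Prop :=
  IsLowerSemiGzFredholm T ∧ 0 ≤ gzIndex T

/-- `g_z`-Weyl. -/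
def IsGzWeyl (T : X →L[ℂ] X) : Prop :=
  IsGzFredholm T ∧ gzIndex T = 0

/-- Upper semi-`g_z`-Browder: direct sum of an upper semi-Browder and a zeroloid operator. -/
def IsUpperSemiGzBrowder (T : X →L[ℂ] X) : Prop :=
  ∃ D : Red T, IsUpperSemiBrowder D.onM ∧ IsZeroloid D.onN

/-- Lower semi-`g_z`-Browder: direct sum of a lower semi-Browder and a zeroloid operator. -/
def IsLowerSemiGzBrowder (T : X →L[ℂ] X) : Prop :=
  ∃ D : Red T, IsLowerSemiBrowder D.onM ∧ IsZeroloid D.onN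

/-- `g_z`-Browder: direct sum of a Browder and a zeroloid operator. -/
def IsGzBrowder (T : X →L[ℂ] X) : Prop :=
  ∃ D : Red T, IsBrowder D.onM ∧ IsZeroloid D.onN

end Reduction

end GzTheory

end

/-!
Let `kₙ` be the `n`-th jump of `S`, the length of `(ker S ∩ ran Sⁿ) / (ker S ∩ ran Sⁿ⁺¹)`, which is
also that of `(ker Sⁿ⁺¹ + ran S) / (ker Sⁿ + ran S)`. Telescoping gives
`α(S) = dim (ker S ∩ ran Sⁿ) + ∑_{i<n} kᵢ` and `β(S) = codim (ker Sⁿ + ran S) + ∑_{i<n} kᵢ`.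
As `ker Sⁿ = ker Sⁿ⁺¹` means `ker S ∩ ran Sⁿ = 0` and `ran Sⁿ = ran Sⁿ⁺¹` means
`ker Sⁿ + ran S = Y`, finite ascent forces `α ≤ β`, finite descent forces `β ≤ α`, and the two are
equivalent when `α = β < ∞`.

If `S` is semi-Fredholm, the jumps eventually vanish and the ranges of all powers are closed, so `S`
maps its closed hyperrange `⋂ₙ ran Sⁿ` onto itself. By the open mapping theorem a kernel vector in
the hyperrange starts a backward orbit `aₙ` of at most geometric growth, and `∑ μⁿ aₙ` is then an
eigenvector function near `0`. Hence the SVEP at `0` makes `S` injective on the hyperrange, which is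
finite ascent; conversely, for finite ascent the Taylor coefficients of an eigenvector function form
a backward orbit and vanish. Both conditions on `S` pass to `S*`, which gives the statement for the
descent. Finally, a zeroloid operator has dense resolvent set, so it and its dual have the SVEP
everywhere, and the SVEP of `T` is that of `T_M` and `T_N` together.
-/

noncomputable section

namespace GzTheory

open Module Filter Topology

section Length

variable {R M N : Type*} [Ring R] [AddCommGroup M] [Module R M] [AddCommGroup N] [Module R N]

theorem length_eq_length_inf_ker_add_length_map (p : Submodule R M) (g : M →ₗ[R] N) :
    length R p = length R ↥(p ⊓ g.ker) + length R (p.map g) := by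
  refine length_eq_add_of_exact (Submodule.inclusion inf_le_left) (g.submoduleMap p)
    (Submodule.inclusion_injective _) (g.submoduleMap_surjective p) fun x => ?_
  simp [LinearMap.submoduleMap, Subtype.ext_iff]

theorem length_map_eq_of_ker_eq {N' : Type*} [AddCommGroup N'] [Module R N'] (p : Submodule R M)
    {g : M →ₗ[R] N} {g' : M →ₗ[R] N'} (h : g.ker = g'.ker) :
    length R (p.map g) = length R (p.map g') := by
  rw [← LinearMap.range_domRestrict, ← LinearMap.range_domRestrict,
    ← (LinearMap.quotKerEquivRange _).length_eq, ← (LinearMap.quotKerEquivRange _).length_eq,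
    LinearMap.ker_domRestrict, LinearMap.ker_domRestrict, h]

theorem length_quotient_eq_length_quotient_sup_add (p q : Submodule R M) :
    length R (M ⧸ p) = length R (M ⧸ p ⊔ q) + length R (q.map p.mkQ) := by
  rw [← (Submodule.quotientQuotientEquivQuotientSup p q).length_eq, add_comm]
  exact length_eq_add_of_exact (q.map p.mkQ).subtype (q.map p.mkQ).mkQ
    (Submodule.subtype_injective _) (Submodule.mkQ_surjective _)
    (LinearMap.exact_subtype_mkQ _)

end Length

theorem eq_add_sum_range_of_eq_succ_add {A : Type*} [AddCommMonoid A] {u k : ℕ → A}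
    (h : ∀ n, u n = u (n + 1) + k n) (n : ℕ) : u 0 = u n + ∑ i ∈ Finset.range n, k i := by
  induction n with
  | zero => simp
  | succ n ih => rw [ih, h n, Finset.sum_range_succ, add_assoc, add_comm (k n)]

theorem eventually_eq_zero_of_eq_succ_add {u k : ℕ → ℕ∞} (h : ∀ n, u n = u (n + 1) + k n)
    (h₀ : u 0 ≠ ⊤) : ∀ᶠ n in atTop, k n = 0 := by
  have hu : Antitone u := antitone_nat_of_succ_le fun n => (h n).symm ▸ le_self_add
  obtain ⟨d, hd⟩ := WellFoundedLT.antitone_chain_condition hu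
  filter_upwards [eventually_ge_atTop d] with n hn
  have hn' : u (n + 1) = u (n + 1) + k n := by rw [← h n, ← hd n hn, hd (n + 1) (by omega)]
  have : u (n + 1) ≠ ⊤ := ne_top_of_le_ne_top h₀ (hu (Nat.zero_le _))
  exact ENat.add_right_injective_of_ne_top this (hn'.symm.trans (add_zero _).symm)

section Jump

variable {R M : Type*} [Ring R] [AddCommGroup M] [Module R M] (f : End R M) (n : ℕ)

theorem ker_pow_succ : (f ^ (n + 1)).ker = f.ker.comap (f ^ n) := by
  rw [pow_succ', Module.End.mul_eq_comp, LinearMap.ker_comp]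

theorem range_pow_succ : (f ^ (n + 1)).range = f.range.map (f ^ n) := by
  rw [pow_succ, Module.End.mul_eq_comp, LinearMap.range_comp]

theorem ker_pow_le_ker_pow_succ : (f ^ n).ker ≤ (f ^ (n + 1)).ker :=
  f.iterateKer.monotone n.le_succ

theorem map_pow_ker_pow_succ : (f ^ (n + 1)).ker.map (f ^ n) = f.ker ⊓ (f ^ n).range := by
  rw [ker_pow_succ, Submodule.map_comap_eq, inf_comm]

theorem comap_pow_range_pow_succ : (f ^ (n + 1)).range.comap (f ^ n) = (f ^ n).ker ⊔ f.range := by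
  rw [range_pow_succ, Submodule.comap_map_eq, sup_comm]

theorem ker_pow_eq_succ_iff :
    (f ^ n).ker = (f ^ (n + 1)).ker ↔ f.ker ⊓ (f ^ n).range = ⊥ := by
  rw [← map_pow_ker_pow_succ, ← LinearMap.le_ker_iff_map]
  exact ⟨ge_of_eq, (ker_pow_le_ker_pow_succ f n).antisymm⟩

theorem range_pow_eq_succ_iff :
    (f ^ n).range = (f ^ (n + 1)).range ↔ (f ^ n).ker ⊔ f.range = ⊤ := by
  rw [← comap_pow_range_pow_succ, ← LinearMap.range_le_iff_comap]
  exact ⟨le_of_eq, fun h => h.antisymm (f.iterateRange.monotone n.le_succ)⟩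

/-- The `n`-th jump `kₙ(f) = length (ker f ∩ ran fⁿ) / (ker f ∩ ran fⁿ⁺¹)` of an endomorphism, the
quotient being realised as the image of `ker f ∩ ran fⁿ` modulo `ran fⁿ⁺¹`. It measures both how
the sequence `ker f ∩ ran fⁿ` decreases and how the sequence `ker fⁿ + ran f` increases. -/
def jump : ℕ∞ :=
  length R ((f.ker ⊓ (f ^ n).range).map (f ^ (n + 1)).range.mkQ)

theorem length_ker_inf_range_pow :
    length R ↥(f.ker ⊓ (f ^ n).range) = length R ↥(f.ker ⊓ (f ^ (n + 1)).range) + jump f n := by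
  have hle : (f ^ (n + 1)).range ≤ (f ^ n).range := f.iterateRange.monotone n.le_succ
  rw [length_eq_length_inf_ker_add_length_map _ (f ^ (n + 1)).range.mkQ, Submodule.ker_mkQ,
    inf_assoc, inf_eq_right.2 hle, jump]

theorem length_quotient_ker_pow_sup_range :
    length R (M ⧸ (f ^ n).ker ⊔ f.range) =
      length R (M ⧸ (f ^ (n + 1)).ker ⊔ f.range) + jump f n := by
  have hsup : (f ^ n).ker ⊔ f.range ⊔ (f ^ (n + 1)).ker = (f ^ (n + 1)).ker ⊔ f.range := by
    rw [sup_right_comm, sup_eq_right.2 (ker_pow_le_ker_pow_succ f n)]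
  have hker : ((f ^ n).ker ⊔ f.range).mkQ.ker = ((f ^ (n + 1)).range.mkQ ∘ₗ (f ^ n)).ker := by
    rw [LinearMap.ker_comp, Submodule.ker_mkQ, Submodule.ker_mkQ, comap_pow_range_pow_succ]
  rw [length_quotient_eq_length_quotient_sup_add _ (f ^ (n + 1)).ker, hsup,
    length_map_eq_of_ker_eq _ hker, Submodule.map_comp, map_pow_ker_pow_succ, jump]

theorem jump_eq_zero_iff : jump f n = 0 ↔ f.ker ⊓ (f ^ n).range ≤ (f ^ (n + 1)).range := by
  rw [jump, length_eq_zero_iff, Submodule.subsingleton_iff_eq_bot, ← LinearMap.le_ker_iff_map,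
    Submodule.ker_mkQ]

theorem jump_eq_zero_iff_ker_pow_succ_le :
    jump f n = 0 ↔ (f ^ (n + 1)).ker ≤ (f ^ n).ker ⊔ f.range := by
  rw [jump_eq_zero_iff, ← map_pow_ker_pow_succ, Submodule.map_le_iff_le_comap,
    comap_pow_range_pow_succ]

theorem length_ker_eq_add_sum_jump :
    length R f.ker = length R ↥(f.ker ⊓ (f ^ n).range) + ∑ i ∈ Finset.range n, jump f i := by
  rw [← eq_add_sum_range_of_eq_succ_add (length_ker_inf_range_pow f) n, pow_zero,
    Module.End.one_eq_id, LinearMap.range_id, inf_top_eq]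

theorem length_quotient_range_eq_add_sum_jump :
    length R (M ⧸ f.range) =
      length R (M ⧸ (f ^ n).ker ⊔ f.range) + ∑ i ∈ Finset.range n, jump f i := by
  rw [← eq_add_sum_range_of_eq_succ_add (length_quotient_ker_pow_sup_range f) n, pow_zero,
    Module.End.one_eq_id, LinearMap.ker_id, bot_sup_eq]

variable {f n}

theorem eventually_jump_eq_zero (h : length R f.ker ≠ ⊤ ∨ length R (M ⧸ f.range) ≠ ⊤) :
    ∀ᶠ n in atTop, jump f n = 0 := by
  rcases h with h | h
  · refine eventually_eq_zero_of_eq_succ_add (length_ker_inf_range_pow f) ?_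
    rwa [length_ker_eq_add_sum_jump f 0, Finset.sum_range_zero, add_zero] at h
  · refine eventually_eq_zero_of_eq_succ_add (length_quotient_ker_pow_sup_range f) ?_
    rwa [length_quotient_range_eq_add_sum_jump f 0, Finset.sum_range_zero, add_zero] at h

theorem length_ker_le_length_quotient_range (h : (f ^ n).ker = (f ^ (n + 1)).ker) :
    length R f.ker ≤ length R (M ⧸ f.range) := by
  rw [ker_pow_eq_succ_iff] at h
  rw [length_ker_eq_add_sum_jump f n, length_quotient_range_eq_add_sum_jump f n, h, length_bot,
    zero_add]
  exact le_add_self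

theorem length_quotient_range_le_length_ker (h : (f ^ n).range = (f ^ (n + 1)).range) :
    length R (M ⧸ f.range) ≤ length R f.ker := by
  rw [range_pow_eq_succ_iff, ← Submodule.Quotient.subsingleton_iff,
    ← length_eq_zero_iff (R := R)] at h
  rw [length_ker_eq_add_sum_jump f n, length_quotient_range_eq_add_sum_jump f n, h, zero_add]
  exact le_add_self

theorem ker_pow_eq_succ_iff_range_pow_eq_succ (hfin : length R f.ker ≠ ⊤)
    (h : length R f.ker = length R (M ⧸ f.range)) :
    (f ^ n).ker = (f ^ (n + 1)).ker ↔ (f ^ n).range = (f ^ (n + 1)).range := by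
  rw [length_ker_eq_add_sum_jump f n] at hfin
  rw [length_ker_eq_add_sum_jump f n, length_quotient_range_eq_add_sum_jump f n] at h
  have hlength := ENat.add_left_injective_of_ne_top (ne_top_of_le_ne_top hfin le_add_self) h
  rw [ker_pow_eq_succ_iff, range_pow_eq_succ_iff, ← Submodule.Quotient.subsingleton_iff,
    ← length_eq_zero_iff (R := R), ← hlength, length_eq_zero_iff,
    Submodule.subsingleton_iff_eq_bot]

variable (f) in
/-- The hyperrange `⋂ₙ ran fⁿ` of an endomorphism. -/
def hyperrange : Submodule R M := ⨅ n, (f ^ n).range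

theorem ker_inf_range_pow_le_range_pow (h : ∀ k ≥ n, jump f k = 0) {m : ℕ} (hm : n ≤ m) :
    f.ker ⊓ (f ^ n).range ≤ (f ^ m).range := by
  induction m, hm using Nat.le_induction with
  | base => exact inf_le_right
  | succ k hk ih => exact (le_inf inf_le_left ih).trans ((jump_eq_zero_iff f k).1 (h k hk))

theorem ker_inf_range_pow_le_hyperrange (h : ∀ k ≥ n, jump f k = 0) :
    f.ker ⊓ (f ^ n).range ≤ hyperrange f := by
  refine le_iInf fun m => (le_total n m).elim (ker_inf_range_pow_le_range_pow h) fun hm => ?_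
  exact inf_le_right.trans (f.iterateRange.monotone hm)

theorem map_hyperrange (h : ∀ k ≥ n, jump f k = 0) : (hyperrange f).map f = hyperrange f := by
  have hsucc (m : ℕ) : (f ^ (m + 1)).range = (f ^ m).range.map f := LinearMap.iterateRange_succ
  have hanti {k m : ℕ} (hkm : k ≤ m) : (f ^ m).range ≤ (f ^ k).range :=
    f.iterateRange.monotone hkm
  refine le_antisymm (le_iInf fun m => ?_) fun y hy => ?_
  · calc (hyperrange f).map f ≤ (f ^ m).range.map f := Submodule.map_mono (iInf_le _ m)
      _ = (f ^ (m + 1)).range := (hsucc m).symm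
      _ ≤ (f ^ m).range := hanti m.le_succ
  have hpreimage (m : ℕ) : ∃ x ∈ (f ^ m).range, f x = y :=
    Submodule.mem_map.1 (hsucc m ▸ (Submodule.mem_iInf _).1 hy (m + 1))
  obtain ⟨x, hx, hxy⟩ := hpreimage n
  refine ⟨x, (Submodule.mem_iInf _).2 fun m => ?_, hxy⟩
  obtain ⟨x', hx', hxy'⟩ := hpreimage (max n m)
  have hsub : x - x' ∈ f.ker ⊓ (f ^ n).range :=
    ⟨by simp [hxy, hxy'], sub_mem hx (hanti (le_max_left n m) hx')⟩
  have hsub_m : x - x' ∈ (f ^ m).range :=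
    (Submodule.mem_iInf _).1 (ker_inf_range_pow_le_hyperrange h hsub) m
  simpa only [sub_add_cancel] using add_mem hsub_m (hanti (le_max_right n m) hx')

theorem eq_zero_of_backward_orbit (h : (f ^ n).ker = (f ^ (n + 1)).ker) {a : ℕ → M}
    (ha₀ : f (a 0) = 0) (ha : ∀ m, f (a (m + 1)) = a m) (m : ℕ) : a m = 0 := by
  have hpow (m k : ℕ) : (f ^ k) (a (m + k)) = a m := by
    induction k with
    | zero => rfl
    | succ k ih => rw [pow_succ, Module.End.mul_apply, ← add_assoc, ha, ih]
  have hker {m : ℕ} (hm : f (a m) = 0) : a m = 0 := by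
    have hmem : a m ∈ f.ker ⊓ (f ^ n).range := ⟨hm, a (m + n), hpow m n⟩
    rwa [(ker_pow_eq_succ_iff f n).1 h] at hmem
  induction m with
  | zero => exact hker ha₀
  | succ m ih => exact hker ((ha m).trans ih)

end Jump

section Cofinite

variable {K V W : Type*} [DivisionRing K] [AddCommGroup V] [Module K V] [AddCommGroup W]
  [Module K W]

theorem cofg_map {p : Submodule K V} (hp : p.CoFG) {g : V →ₗ[K] W} (hg : g.range.CoFG) :
    (p.map g).CoFG := by
  obtain ⟨q, hq⟩ := p.exists_isCompl
  obtain ⟨r, hr⟩ := g.range.exists_isCompl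
  refine Submodule.FG.cofg_of_codisjoint (S := q.map g ⊔ r) (codisjoint_iff.2 ?_)
    (((hp.fg_of_isCompl hq).map g).sup (hg.fg_of_isCompl hr))
  rw [sup_right_comm, ← Submodule.map_sup, hq.symm.sup_eq_top, Submodule.map_top, hr.sup_eq_top]

theorem cofg_range_pow {f : End K V} (hf : f.range.CoFG) (n : ℕ) : (f ^ n).range.CoFG := by
  induction n with
  | zero => rw [pow_zero, Module.End.one_eq_id, LinearMap.range_id]; infer_instance
  | succ n ih =>
    rw [pow_succ', Module.End.mul_eq_comp, LinearMap.range_comp]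
    exact cofg_map ih hf

end Cofinite

section SVEP

variable {Y Z : Type*} [NormedAddCommGroup Y] [NormedSpace ℂ Y]
  [NormedAddCommGroup Z] [NormedSpace ℂ Z] {S : Y →L[ℂ] Y} {T : Z →L[ℂ] Z} {z : ℂ}

theorem hasSVEPAt_iff :
    HasSVEPAt S z ↔ ∀ U : Set ℂ, IsOpen U → IsPreconnected U → z ∈ U → ∀ f : ℂ → Y,
      AnalyticOnNhd ℂ f U → (∀ μ ∈ U, S (f μ) = μ • f μ) → ∀ μ ∈ U, f μ = 0 := by
  simp only [HasSVEPAt, sub_apply, smul_apply, ContinuousLinearMap.id_apply, sub_eq_zero]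

theorem HasSVEPAt.of_injective (hT : HasSVEPAt T z) (J : Y →L[ℂ] Z)
    (hJ : Function.Injective J) (h : ∀ y, J (S y) = T (J y)) : HasSVEPAt S z := by
  rw [hasSVEPAt_iff] at hT ⊢
  intro U hU hUc hz f hf hfU μ hμ
  refine hJ ((hT U hU hUc hz (J ∘ f) (J.comp_analyticOnNhd hf) (fun w hw => ?_) μ hμ).trans
    J.map_zero.symm)
  rw [Function.comp_apply, ← h, hfU w hw, map_smul]

theorem HasSVEPAt.dualOp_of_surjective (hS : HasSVEPAt (dualOp S) z) (P : Y →L[ℂ] Z)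
    (hP : Function.Surjective P) (h : ∀ y, P (S y) = T (P y)) : HasSVEPAt (dualOp T) z := by
  refine hS.of_injective (ContinuousLinearMap.precomp ℂ P) (fun φ ψ hφψ => ?_) fun φ => ?_
  · exact ContinuousLinearMap.ext (hP.forall.2 (DFunLike.congr_fun hφψ))
  · exact ContinuousLinearMap.ext fun y => congrArg φ (h y).symm

theorem hasSVEPAt_prodMap_iff :
    HasSVEPAt (S.prodMap T) z ↔ HasSVEPAt S z ∧ HasSVEPAt T z := by
  refine ⟨fun h => ⟨h.of_injective (.inl ℂ Y Z) (Prod.mk_left_injective 0) fun y => by simp,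
    h.of_injective (.inr ℂ Y Z) (Prod.mk_right_injective 0) fun y => by simp⟩, fun ⟨hS, hT⟩ => ?_⟩
  rw [hasSVEPAt_iff] at *
  intro U hU hUc hz f hf hfU μ hμ
  exact Prod.ext
    (hS U hU hUc hz _ ((ContinuousLinearMap.fst ℂ Y Z).comp_analyticOnNhd hf)
      (fun w hw => congrArg Prod.fst (hfU w hw)) μ hμ)
    (hT U hU hUc hz _ ((ContinuousLinearMap.snd ℂ Y Z).comp_analyticOnNhd hf)
      (fun w hw => congrArg Prod.snd (hfU w hw)) μ hμ)

theorem hasSVEPAt_dualOp_prodMap_iff :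
    HasSVEPAt (dualOp (S.prodMap T)) z ↔ HasSVEPAt (dualOp S) z ∧ HasSVEPAt (dualOp T) z := by
  refine ⟨fun h => ⟨h.dualOp_of_surjective (.fst ℂ Y Z) Prod.fst_surjective fun _ => rfl,
    h.dualOp_of_surjective (.snd ℂ Y Z) Prod.snd_surjective fun _ => rfl⟩, fun h => ?_⟩
  refine (hasSVEPAt_prodMap_iff.2 h).of_injective
    ((ContinuousLinearMap.precomp ℂ (.inl ℂ Y Z)).prod (.precomp ℂ (.inr ℂ Y Z)))
    (fun φ ψ hφψ => ?_) fun φ => ?_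
  · exact ContinuousLinearMap.prod_ext (congrArg Prod.fst hφψ) (congrArg Prod.snd hφψ)
  · ext y <;> simp [dualOp]

theorem hasSVEPAt_of_dense {D : Set ℂ} (hD : Dense D)
    (h : ∀ μ ∈ D, ∀ y, S y = μ • y → y = 0) : HasSVEPAt S z := by
  rw [hasSVEPAt_iff]
  intro U hU _ _ f hf hfU
  have hzero : Set.EqOn f 0 (U ∩ D) := fun μ hμ => h μ hμ.2 _ (hfU μ hμ.1)
  exact hzero.of_subset_closure hf.continuousOn continuousOn_const Set.inter_subset_left
    (hD.open_subset_closure_inter hU)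

theorem dense_compl_of_derivedSet_subset_singleton {σ : Set ℂ} (hσ : derivedSet σ ⊆ {z}) :
    Dense σᶜ := by
  have hint : interior σ ⊆ {z} := fun w hw => hσ (accPt_iff_frequently_nhdsNE.2
    (Eventually.frequently (mem_nhdsWithin_of_mem_nhds (mem_interior_iff_mem_nhds.1 hw))))
  rw [← interior_eq_empty_iff_dense_compl, ← Set.subset_empty_iff, ← interior_singleton z]
  exact interior_maximal hint isOpen_interior

theorem bijective_sub_smul_of_notMem_spectrum {μ : ℂ} (hμ : μ ∉ spectrum ℂ S) :
    Function.Bijective fun y => μ • y - S y := by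
  have hunit := (spectrum.notMem_iff.1 hμ).map ContinuousLinearMap.toLinearMapRingHom
  exact (End.isUnit_iff _).1 hunit

theorem IsZeroloid.hasSVEPAt (hS : IsZeroloid S) : HasSVEPAt S z :=
  hasSVEPAt_of_dense (dense_compl_of_derivedSet_subset_singleton hS) fun μ hμ y hy =>
    (bijective_sub_smul_of_notMem_spectrum hμ).injective (by simp [hy])

theorem IsZeroloid.hasSVEPAt_dualOp (hS : IsZeroloid S) : HasSVEPAt (dualOp S) z :=
  hasSVEPAt_of_dense (dense_compl_of_derivedSet_subset_singleton hS) fun μ hμ φ hφ => by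
    ext x
    obtain ⟨y, rfl⟩ := (bijective_sub_smul_of_notMem_spectrum hμ).surjective x
    have hy : φ (S y) = μ • φ y := DFunLike.congr_fun hφ y
    simp [hy]

theorem ascent_lt_top_iff : ascent S < ⊤ ↔ ∃ n : ℕ, (S ^ n).ker = (S ^ (n + 1)).ker := by
  rw [ascent, sInf_lt_iff]
  simp

theorem descent_lt_top_iff : descent S < ⊤ ↔ ∃ n : ℕ, (S ^ n).range = (S ^ (n + 1)).range := by
  rw [descent, sInf_lt_iff]
  simp

theorem apply_coeff_succ_of_apply_eq_smul {f : ℂ → Y} {p : FormalMultilinearSeries ℂ ℂ Y}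
    (hf : HasFPowerSeriesAt f p 0) (h : ∀ᶠ μ in 𝓝 0, S (f μ) = μ • f μ) (n : ℕ) :
    S (p.coeff (n + 1)) = p.coeff n := by
  have h0 : S (f 0) = 0 := by simpa using h.self_of_nhds
  have hslope := hf.has_fpower_series_dslope_fslope
  have hSslope : (fun μ => S (dslope f 0 μ)) =ᶠ[𝓝 0] f := by
    refine (ContinuousAt.eventuallyEq_nhds_iff_eventuallyEq_nhdsNE
      (S.continuous.continuousAt.comp hslope.continuousAt) hf.continuousAt).1 ?_
    filter_upwards [h.filter_mono nhdsWithin_le_nhds, self_mem_nhdsWithin] with μ hμ hμ0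
    rw [Function.comp_apply, dslope_of_ne _ hμ0, slope_def_module, map_smul, map_sub, h0, hμ,
      sub_zero, sub_zero, inv_smul_smul₀ hμ0]
  have hseries : S.compFormalMultilinearSeries p.fslope = p := by
    obtain ⟨r, hr⟩ := hslope
    have hSr := (S.comp_hasFPowerSeriesOnBall hr).hasFPowerSeriesAt
    exact hSr.eq_formalMultilinearSeries_of_eventually hf hSslope
  calc S (p.coeff (n + 1)) = (S.compFormalMultilinearSeries p.fslope).coeff n := by
        rw [← p.coeff_fslope]; rfl
    _ = p.coeff n := by rw [hseries]

theorem hasSVEPAt_zero_of_ascent_lt_top (hS : ascent S < ⊤) : HasSVEPAt S 0 := by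
  obtain ⟨n, hn⟩ := ascent_lt_top_iff.1 hS
  rw [hasSVEPAt_iff]
  intro U hU hUc h0 f hf hfU
  obtain ⟨p, hp⟩ := hf 0 h0
  have heigen : ∀ᶠ μ in 𝓝 0, S (f μ) = μ • f μ := eventually_of_mem (hU.mem_nhds h0) hfU
  have hcoeff (m : ℕ) : p.coeff m = 0 := by
    refine GzTheory.eq_zero_of_backward_orbit (f := (S : End ℂ Y)) (n := n) ?_ ?_
      (apply_coeff_succ_of_apply_eq_smul hp heigen) m
    · simpa only [← ContinuousLinearMap.toLinearMap_pow] using hn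
    · have hcoeff₀ : p.coeff 0 = f 0 := hp.coeff_zero _
      simpa [hcoeff₀] using hfU 0 h0
  have hzero : p = 0 := FormalMultilinearSeries.ext fun m => p.coeff_eq_zero.1 (hcoeff m)
  exact hf.eqOn_zero_of_preconnected_of_eventuallyEq_zero hUc h0
    (HasFPowerSeriesAt.eventually_eq_zero (hzero ▸ hp))

theorem HasSVEPAt.eq_zero_of_backward_orbit [CompleteSpace Y] (hS : HasSVEPAt S 0) {a : ℕ → Y}
    (ha₀ : S (a 0) = 0) (ha : ∀ n, S (a (n + 1)) = a n) {K C : ℝ} (hC : 0 < C)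
    (hnorm : ∀ n, ‖a n‖ ≤ C ^ n * K) : a 0 = 0 := by
  set U := Metric.ball (0 : ℂ) (1 / (2 * C))
  have h0 : (0 : ℂ) ∈ U := Metric.mem_ball_self (by positivity)
  have hbound (n : ℕ) (w : ℂ) (hw : w ∈ U) : ‖w ^ n • a n‖ ≤ (1 / 2) ^ n * K := by
    have hw' : ‖w‖ ≤ 1 / (2 * C) := (mem_ball_zero_iff.1 hw).le
    calc ‖w ^ n • a n‖ = ‖w‖ ^ n * ‖a n‖ := by rw [norm_smul, norm_pow]
      _ ≤ (1 / (2 * C)) ^ n * (C ^ n * K) := by gcongr; exact hnorm n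
      _ = (1 / 2) ^ n * K := by rw [← mul_assoc, ← mul_pow]; field_simp
  have hsummable : Summable fun n : ℕ => (1 / 2 : ℝ) ^ n * K := summable_geometric_two.mul_right K
  have hsum (w : ℂ) (hw : w ∈ U) : HasSum (fun n => w ^ n • a n) (∑' n, w ^ n • a n) :=
    (hsummable.of_norm_bounded fun n => hbound n w hw).hasSum
  have hanalytic : AnalyticOnNhd ℂ (fun w => ∑' n, w ^ n • a n) U :=
    (Complex.differentiableOn_tsum_of_summable_norm hsummable (fun n => by fun_prop)
      Metric.isOpen_ball hbound).analyticOnNhd Metric.isOpen_ball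
  have heigen (w : ℂ) (hw : w ∈ U) : S (∑' n, w ^ n • a n) = w • ∑' n, w ^ n • a n := by
    have hshift : HasSum (fun n => S (w ^ (n + 1) • a (n + 1))) (w • ∑' n, w ^ n • a n) := by
      simpa only [map_smul, ha, pow_succ', mul_smul] using (hsum w hw).const_smul w
    refine (S.hasSum (hsum w hw)).unique ((hasSum_nat_add_iff' 1).1 ?_)
    simpa [ha₀] using hshift
  have hzero := hasSVEPAt_iff.1 hS U Metric.isOpen_ball (convex_ball 0 _).isPreconnected h0 _
    hanalytic heigen 0 h0
  rwa [tsum_eq_single 0 fun n hn => by rw [zero_pow hn, zero_smul], pow_zero, one_smul] at hzero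

theorem HasSVEPAt.injective_of_surjective [CompleteSpace Y] (hS : HasSVEPAt S 0)
    (hsurj : Function.Surjective S) : Function.Injective S := by
  obtain ⟨C, hC, hpre⟩ := S.exists_preimage_norm_le hsurj
  choose r hr hnorm using hpre
  refine (injective_iff_map_eq_zero S).2 fun x hx => ?_
  refine hS.eq_zero_of_backward_orbit (a := fun n => r^[n] x) (K := ‖x‖) hx (fun n => ?_) hC
    fun n => ?_
  · rw [Function.iterate_succ_apply', hr]
  · induction n with
    | zero => simp
    | succ n ih =>
      rw [Function.iterate_succ_apply']
      calc ‖r (r^[n] x)‖ ≤ C * ‖r^[n] x‖ := hnorm _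
        _ ≤ C * (C ^ n * ‖x‖) := by gcongr
        _ = C ^ (n + 1) * ‖x‖ := by ring

end SVEP

section ClosedRange

variable {𝕜 E F : Type*} [NontriviallyNormedField 𝕜] [NormedAddCommGroup E] [NormedSpace 𝕜 E]
  [CompleteSpace E] [NormedAddCommGroup F] [NormedSpace 𝕜 F] [CompleteSpace F] {A : E →L[𝕜] F}

theorem isQuotientMap_rangeRestrict (hA : IsClosed (A.range : Set F)) :
    IsQuotientMap A.rangeRestrict :=
  have : CompleteSpace A.range := hA.completeSpace_coe
  A.rangeRestrict.isQuotientMap A.toLinearMap.surjective_rangeRestrict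

theorem isClosed_map_of_finiteDimensional_ker [CompleteSpace 𝕜] [FiniteDimensional 𝕜 A.ker]
    (hA : IsClosed (A.range : Set F)) {p : Submodule 𝕜 E} (hp : IsClosed (p : Set E)) :
    IsClosed (p.map A.toLinearMap : Set F) := by
  have hpreimage : A.rangeRestrict ⁻¹' (A.rangeRestrict '' p) = (p ⊔ A.ker : Submodule 𝕜 E) := by
    have hker : A.rangeRestrict.toLinearMap.ker = A.ker := A.toLinearMap.ker_rangeRestrict
    rw [← hker, ← Submodule.comap_map_eq]
    rfl
  have hclosed : IsClosed (A.rangeRestrict '' p) := by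
    rw [← (isQuotientMap_rangeRestrict hA).isClosed_preimage, hpreimage]
    exact p.isClosed_sup_finiteDimensional _ hp
  simpa only [Set.image_image, Submodule.map_coe]
    using! hA.isClosedEmbedding_subtypeVal.isClosedMap _ hclosed

theorem isClosed_range_of_cofg [CompleteSpace 𝕜] (hA : A.range.CoFG) :
    IsClosed (A.range : Set F) := by
  obtain ⟨G, hG⟩ := A.range.exists_isCompl
  have : FiniteDimensional 𝕜 G := .of_fg (hA.fg_of_isCompl hG)
  have : IsClosed (A.ker : Set E) := A.isClosed_ker
  have hrange : (A.ker.liftQL A le_rfl).range = A.range := Submodule.range_liftQ _ _ _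
  rw [← hrange] at hG ⊢
  exact ContinuousLinearMap.closed_complemented_range_of_isCompl_of_ker_eq_bot _ G hG
    G.closed_of_finiteDimensional (Submodule.ker_liftQ_eq_bot _ _ _ le_rfl)

end ClosedRange

section UniformDescent

variable {Y : Type*} [NormedAddCommGroup Y] [NormedSpace ℂ Y] {S : Y →L[ℂ] Y}

theorem nullity_eq_length : nullity S = length ℂ S.ker :=
  (length_eq_rank ℂ _).symm

theorem deficiency_eq_length : deficiency S = length ℂ (Y ⧸ S.range) :=
  (length_eq_rank ℂ _).symm

theorem IsUpperSemiFredholm.isClosed_range_pow [CompleteSpace Y] (hS : IsUpperSemiFredholm S)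
    (n : ℕ) : IsClosed ((S ^ n).range : Set Y) := by
  have := (nullity_lt_top_iff S).1 hS.1
  induction n with
  | zero => simp [End.one_eq_id]
  | succ n ih =>
    have hsucc : (S ^ (n + 1)).range = (S ^ n).range.map S.toLinearMap := by
      rw [pow_succ']
      exact LinearMap.range_comp _ _
    rw [hsucc]
    exact isClosed_map_of_finiteDimensional_ker hS.2 ih

theorem IsLowerSemiFredholm.isClosed_range_pow [CompleteSpace Y] (hS : IsLowerSemiFredholm S)
    (n : ℕ) : IsClosed ((S ^ n).range : Set Y) := by
  have hcofg : S.range.CoFG := (deficiency_lt_top_iff S).1 hS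
  refine isClosed_range_of_cofg ?_
  rw [ContinuousLinearMap.toLinearMap_pow]
  exact cofg_range_pow hcofg n

/-- An operator all of whose powers have closed range and whose jumps eventually vanish. This is
the special case with closed ranges of Grabiner's notion of topological uniform descent, and it is
shared by semi-Fredholm operators and their duals. -/
structure HasTopologicalUniformDescent (S : Y →L[ℂ] Y) : Prop where
  isClosed_range_pow (n : ℕ) : IsClosed ((S ^ n).range : Set Y)
  eventually_jump_eq_zero : ∀ᶠ n in atTop, jump (S : End ℂ Y) n = 0

theorem IsSemiFredholm.nullity_ne_top_or_deficiency_ne_top (hS : IsSemiFredholm S) :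
    nullity S ≠ ⊤ ∨ deficiency S ≠ ⊤ :=
  hS.imp (·.1.ne) LT.lt.ne

theorem IsSemiFredholm.hasTopologicalUniformDescent [CompleteSpace Y] (hS : IsSemiFredholm S) :
    HasTopologicalUniformDescent S where
  isClosed_range_pow := hS.elim (·.isClosed_range_pow) (·.isClosed_range_pow)
  eventually_jump_eq_zero := eventually_jump_eq_zero <| by
    simpa only [nullity_eq_length, deficiency_eq_length]
      using hS.nullity_ne_top_or_deficiency_ne_top

theorem HasTopologicalUniformDescent.isClosed_hyperrange (hS : HasTopologicalUniformDescent S) :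
    IsClosed (hyperrange (S : End ℂ Y) : Set Y) := by
  simp only [hyperrange, Submodule.coe_iInf, ← ContinuousLinearMap.toLinearMap_pow]
  exact isClosed_iInter hS.isClosed_range_pow

theorem HasTopologicalUniformDescent.disjoint_ker_hyperrange [CompleteSpace Y]
    (hS : HasTopologicalUniformDescent S) (hsvep : HasSVEPAt S 0) :
    Disjoint S.ker (hyperrange (S : End ℂ Y)) := by
  obtain ⟨d, hd⟩ := eventually_atTop.1 hS.eventually_jump_eq_zero
  have hmap := map_hyperrange hd
  set R := hyperrange (S : End ℂ Y)
  have : CompleteSpace R := hS.isClosed_hyperrange.completeSpace_coe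
  have hmaps : ∀ x ∈ R, S x ∈ R := fun x hx => hmap ▸ Submodule.mem_map_of_mem hx
  have hsvepR : HasSVEPAt (S.restrict hmaps) 0 :=
    hsvep.of_injective R.subtypeL R.subtype_injective fun _ => rfl
  have hsurj : Function.Surjective (S.restrict hmaps) := fun ⟨y, hy⟩ => by
    obtain ⟨x, hx, rfl⟩ := Submodule.mem_map.1 (hmap ▸ hy)
    exact ⟨⟨x, hx⟩, rfl⟩
  refine Submodule.disjoint_def.2 fun x hx hxR => ?_
  exact congrArg Subtype.val (hsvepR.injective_of_surjective hsurj
    (a₁ := ⟨x, hxR⟩) (a₂ := 0) (Subtype.ext (hx.trans S.map_zero.symm)))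

theorem HasTopologicalUniformDescent.ascent_lt_top [CompleteSpace Y]
    (hS : HasTopologicalUniformDescent S) (hsvep : HasSVEPAt S 0) : ascent S < ⊤ := by
  obtain ⟨d, hd⟩ := eventually_atTop.1 hS.eventually_jump_eq_zero
  refine ascent_lt_top_iff.2 ⟨d, ?_⟩
  simp only [ContinuousLinearMap.toLinearMap_pow]
  rw [ker_pow_eq_succ_iff, ← le_bot_iff, ← (hS.disjoint_ker_hyperrange hsvep).eq_bot]
  exact le_inf inf_le_left (ker_inf_range_pow_le_hyperrange hd)

end UniformDescent

section Duality

variable {Y : Type*} [NormedAddCommGroup Y] [NormedSpace ℂ Y] {A B S : Y →L[ℂ] Y}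

theorem dualOp_pow (n : ℕ) : dualOp S ^ n = dualOp (S ^ n) := by
  induction n with
  | zero => rfl
  | succ n ih => exact (congrArg (· * dualOp S) ih).trans (congrArg dualOp (pow_succ' S n).symm)

theorem mem_ker_dualOp_iff {φ : StrongDual ℂ Y} : φ ∈ (dualOp A).ker ↔ A.range ≤ φ.ker := by
  rw [LinearMap.range_le_ker_iff, LinearMap.ext_iff]
  exact DFunLike.ext_iff

theorem mem_range_dualOp_iff [CompleteSpace Y] (hA : IsClosed (A.range : Set Y))
    {φ : StrongDual ℂ Y} : φ ∈ (dualOp A).range ↔ A.ker ≤ φ.ker := by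
  constructor
  · rintro ⟨ψ, rfl⟩ x (hx : A x = 0)
    exact (congrArg ψ hx).trans ψ.map_zero
  · intro h
    let ψ₀ : A.range →ₗ[ℂ] ℂ := A.ker.liftQ φ.toLinearMap h ∘ₗ A.quotKerEquivRange.symm
    have hψ₀ (x : Y) : ψ₀ (A.rangeRestrict x) = φ x :=
      congrArg (A.ker.liftQ φ.toLinearMap h) (A.toLinearMap.quotKerEquivRange_symm_apply_image x _)
    have hcont : Continuous ψ₀ :=
      (isQuotientMap_rangeRestrict hA).continuous_iff.2 (φ.continuous.congr fun x => (hψ₀ x).symm)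
    obtain ⟨ψ, hψ, -⟩ := exists_extension_norm_eq A.range ⟨ψ₀, hcont⟩
    exact ⟨ψ, ContinuousLinearMap.ext fun x => (hψ _).trans (hψ₀ x)⟩

theorem le_of_forall_le_ker {p q : Submodule ℂ Y} (hq : IsClosed (q : Set Y))
    (h : ∀ φ : StrongDual ℂ Y, q ≤ φ.ker → p ≤ φ.ker) : p ≤ q := by
  intro x hx
  by_contra hxq
  obtain ⟨ψ, hψ⟩ := SeparatingDual.exists_ne_zero (R := ℂ)
    (mt (Submodule.Quotient.mk_eq_zero q).1 hxq)
  refine hψ (h (ψ.comp q.mkQL) (fun y hy => ?_) hx)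
  exact (congrArg ψ ((Submodule.Quotient.mk_eq_zero q).2 hy)).trans ψ.map_zero

theorem range_le_range_of_ker_dualOp_le (hB : IsClosed (B.range : Set Y))
    (h : (dualOp B).ker ≤ (dualOp A).ker) : A.range ≤ B.range :=
  le_of_forall_le_ker hB fun _ hφ => mem_ker_dualOp_iff.1 (h (mem_ker_dualOp_iff.2 hφ))

theorem isClosed_range_dualOp [CompleteSpace Y] (hA : IsClosed (A.range : Set Y)) :
    IsClosed ((dualOp A).range : Set (StrongDual ℂ Y)) := by
  have hrange : ((dualOp A).range : Set (StrongDual ℂ Y)) = ⋂ x ∈ A.ker, {φ | φ x = 0} := by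
    ext φ
    simp [mem_range_dualOp_iff hA, SetLike.le_def]
  rw [hrange]
  exact isClosed_biInter fun x _ => isClosed_eq (by fun_prop) continuous_const

theorem HasTopologicalUniformDescent.dualOp [CompleteSpace Y]
    (hS : HasTopologicalUniformDescent S) : HasTopologicalUniformDescent (dualOp S) where
  isClosed_range_pow n := by
    rw [dualOp_pow]
    exact isClosed_range_dualOp (hS.isClosed_range_pow n)
  eventually_jump_eq_zero := by
    filter_upwards [hS.eventually_jump_eq_zero] with n hn
    rw [jump_eq_zero_iff_ker_pow_succ_le] at hn
    rw [jump_eq_zero_iff]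
    simp only [← ContinuousLinearMap.toLinearMap_pow, dualOp_pow] at hn ⊢
    rintro φ ⟨hφker, hφrange⟩
    rw [SetLike.mem_coe, mem_ker_dualOp_iff] at hφker
    rw [SetLike.mem_coe, mem_range_dualOp_iff (hS.isClosed_range_pow _)] at hφrange
    rw [mem_range_dualOp_iff (hS.isClosed_range_pow _)]
    exact hn.trans (sup_le hφrange hφker)

theorem ascent_dualOp_lt_top_of_descent_lt_top (h : descent S < ⊤) : ascent (dualOp S) < ⊤ := by
  obtain ⟨n, hn⟩ := descent_lt_top_iff.1 h
  refine ascent_lt_top_iff.2 ⟨n, ?_⟩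
  ext φ
  rw [dualOp_pow, dualOp_pow, mem_ker_dualOp_iff, mem_ker_dualOp_iff, hn]

theorem HasTopologicalUniformDescent.descent_lt_top [CompleteSpace Y]
    (hS : HasTopologicalUniformDescent S) (hsvep : HasSVEPAt (GzTheory.dualOp S) 0) :
    descent S < ⊤ := by
  obtain ⟨n, hn⟩ := ascent_lt_top_iff.1 (hS.dualOp.ascent_lt_top hsvep)
  rw [dualOp_pow, dualOp_pow] at hn
  exact descent_lt_top_iff.2 ⟨n, le_antisymm
    (range_le_range_of_ker_dualOp_le (hS.isClosed_range_pow _) hn.ge)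
    (range_le_range_of_ker_dualOp_le (hS.isClosed_range_pow _) hn.le)⟩

theorem hasSVEPAt_dualOp_zero_of_descent_lt_top (h : descent S < ⊤) :
    HasSVEPAt (dualOp S) 0 :=
  hasSVEPAt_zero_of_ascent_lt_top (ascent_dualOp_lt_top_of_descent_lt_top h)

end Duality

section Index

variable {Y : Type*} [NormedAddCommGroup Y] [NormedSpace ℂ Y] {S : Y →L[ℂ] Y}

theorem nullity_le_deficiency_of_ascent_lt_top (h : ascent S < ⊤) : nullity S ≤ deficiency S := by
  obtain ⟨n, hn⟩ := ascent_lt_top_iff.1 h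
  simp only [ContinuousLinearMap.toLinearMap_pow] at hn
  rw [nullity_eq_length, deficiency_eq_length]
  exact length_ker_le_length_quotient_range hn

theorem deficiency_le_nullity_of_descent_lt_top (h : descent S < ⊤) :
    deficiency S ≤ nullity S := by
  obtain ⟨n, hn⟩ := descent_lt_top_iff.1 h
  simp only [ContinuousLinearMap.toLinearMap_pow] at hn
  rw [nullity_eq_length, deficiency_eq_length]
  exact length_quotient_range_le_length_ker hn

theorem ascent_lt_top_iff_descent_lt_top (hfin : nullity S ≠ ⊤)
    (heq : nullity S = deficiency S) : ascent S < ⊤ ↔ descent S < ⊤ := by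
  rw [nullity_eq_length] at hfin heq
  rw [deficiency_eq_length] at heq
  rw [ascent_lt_top_iff, descent_lt_top_iff]
  simp only [ContinuousLinearMap.toLinearMap_pow]
  exact exists_congr fun n => ker_pow_eq_succ_iff_range_pow_eq_succ hfin heq

theorem index_nonpos_iff : index S ≤ 0 ↔ nullity S ≤ deficiency S := by
  rw [index, EReal.sub_nonpos, EReal.coe_ennreal_le_coe_ennreal_iff, ENat.toENNReal_le]

theorem IsSemiFredholm.index_nonneg_iff (hS : IsSemiFredholm S) :
    0 ≤ index S ↔ deficiency S ≤ nullity S := by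
  have hne_top : (((nullity S : ℕ∞) : ENNReal) : EReal) ≠ ⊤ ∨
      (((deficiency S : ℕ∞) : ENNReal) : EReal) ≠ ⊤ := by
    simpa using hS.nullity_ne_top_or_deficiency_ne_top
  rw [index, EReal.sub_nonneg hne_top (Or.inl (EReal.coe_ennreal_ne_bot _)),
    EReal.coe_ennreal_le_coe_ennreal_iff, ENat.toENNReal_le]

theorem IsSemiFredholm.index_eq_zero_iff (hS : IsSemiFredholm S) :
    index S = 0 ↔ nullity S = deficiency S := by
  rw [le_antisymm_iff, index_nonpos_iff, hS.index_nonneg_iff, ← le_antisymm_iff]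

variable [CompleteSpace Y]

theorem IsSemiFredholm.isFredholm_of_index_eq_zero (hS : IsSemiFredholm S) (h : index S = 0) :
    S.IsFredholm := by
  rw [hS.index_eq_zero_iff] at h
  rw [isFredholm_iff]
  rcases hS with hU | hL
  · exact ⟨hU, h.symm.trans_lt hU.1⟩
  · exact ⟨⟨h.trans_lt hL, by simpa only [pow_one] using hL.isClosed_range_pow 1⟩, hL⟩

theorem IsSemiFredholm.isBrowder_of_index_eq_zero (hS : IsSemiFredholm S) (h : index S = 0)
    (hsvep : HasSVEPAt S 0 ∨ HasSVEPAt (dualOp S) 0) : IsBrowder S := by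
  have hF := hS.isFredholm_of_index_eq_zero h
  have hiff := ascent_lt_top_iff_descent_lt_top ((isFredholm_iff S).1 hF).1.1.ne
    (hS.index_eq_zero_iff.1 h)
  rcases hsvep with hsvep | hsvep
  · have hp := hS.hasTopologicalUniformDescent.ascent_lt_top hsvep
    exact ⟨hF, hp, hiff.1 hp⟩
  · have hq := hS.hasTopologicalUniformDescent.descent_lt_top hsvep
    exact ⟨hF, hiff.2 hq, hq⟩

end Index

section GzReduction

variable {X : Type*} [NormedAddCommGroup X] [NormedSpace ℂ X] {T : X →L[ℂ] X} {z : ℂ}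

theorem exists_gzIndex_eq (h : ∃ D : Red T, IsSemiFredholm D.onM ∧ IsZeroloid D.onN) :
    ∃ D : Red T, IsSemiFredholm D.onM ∧ IsZeroloid D.onN ∧ gzIndex T = index D.onM :=
  ⟨h.choose, h.choose_spec.1, h.choose_spec.2, dif_pos h⟩

variable [CompleteSpace X]

theorem Red.completeSpace_M (D : Red T) : CompleteSpace D.M :=
  D.isClosed_M.completeSpace_coe

theorem Red.exists_equiv_prodMap (D : Red T) :
    ∃ e : (D.M × D.N) ≃L[ℂ] X, ∀ y, e (D.onM.prodMap D.onN y) = T (e y) :=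
  ⟨Submodule.prodEquivOfIsTopCompl D.M D.N
    (Submodule.IsCompl.isTopCompl_of_isClosed D.isCompl D.isClosed_M D.isClosed_N),
    fun y => (T.map_add y.1 y.2).symm⟩

theorem Red.hasSVEPAt_iff (D : Red T) :
    HasSVEPAt T z ↔ HasSVEPAt D.onM z ∧ HasSVEPAt D.onN z := by
  obtain ⟨e, he⟩ := D.exists_equiv_prodMap
  rw [← hasSVEPAt_prodMap_iff]
  refine ⟨fun h => h.of_injective e.toContinuousLinearMap e.injective he,
    fun h => h.of_injective e.symm.toContinuousLinearMap e.symm.injective fun x => ?_⟩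
  exact e.symm_apply_eq.2 (by rw [ContinuousLinearEquiv.coe_coe, he, e.apply_symm_apply])

theorem Red.hasSVEPAt_dualOp_iff (D : Red T) :
    HasSVEPAt (dualOp T) z ↔ HasSVEPAt (dualOp D.onM) z ∧ HasSVEPAt (dualOp D.onN) z := by
  obtain ⟨e, he⟩ := D.exists_equiv_prodMap
  rw [← hasSVEPAt_dualOp_prodMap_iff]
  refine ⟨fun h => h.dualOp_of_surjective e.symm.toContinuousLinearMap e.symm.surjective
    fun x => ?_, fun h => h.dualOp_of_surjective e.toContinuousLinearMap e.surjective he⟩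
  exact e.symm_apply_eq.2 (by rw [ContinuousLinearEquiv.coe_coe, he, e.apply_symm_apply])

theorem gzIndex_nonpos (h : ∃ D : Red T, IsSemiFredholm D.onM ∧ IsZeroloid D.onN)
    (hT : HasSVEPAt T 0) : gzIndex T ≤ 0 := by
  obtain ⟨D, hM, -, hindex⟩ := exists_gzIndex_eq h
  have := D.completeSpace_M
  rw [hindex, index_nonpos_iff]
  exact nullity_le_deficiency_of_ascent_lt_top
    (hM.hasTopologicalUniformDescent.ascent_lt_top (D.hasSVEPAt_iff.1 hT).1)

theorem gzIndex_nonneg (h : ∃ D : Red T, IsSemiFredholm D.onM ∧ IsZeroloid D.onN)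
    (hT : HasSVEPAt (dualOp T) 0) : 0 ≤ gzIndex T := by
  obtain ⟨D, hM, -, hindex⟩ := exists_gzIndex_eq h
  have := D.completeSpace_M
  rw [hindex, hM.index_nonneg_iff]
  exact deficiency_le_nullity_of_descent_lt_top
    (hM.hasTopologicalUniformDescent.descent_lt_top (D.hasSVEPAt_dualOp_iff.1 hT).1)

theorem IsUpperSemiGzBrowder.hasSVEPAt (h : IsUpperSemiGzBrowder T) : HasSVEPAt T 0 := by
  obtain ⟨D, hM, hN⟩ := h
  exact D.hasSVEPAt_iff.2 ⟨hasSVEPAt_zero_of_ascent_lt_top hM.2, hN.hasSVEPAt⟩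

theorem IsLowerSemiGzBrowder.hasSVEPAt_dualOp (h : IsLowerSemiGzBrowder T) :
    HasSVEPAt (dualOp T) 0 := by
  obtain ⟨D, hM, hN⟩ := h
  exact D.hasSVEPAt_dualOp_iff.2
    ⟨hasSVEPAt_dualOp_zero_of_descent_lt_top hM.2, hN.hasSVEPAt_dualOp⟩

theorem IsGzBrowder.isUpperSemiGzBrowder (h : IsGzBrowder T) : IsUpperSemiGzBrowder T := by
  obtain ⟨D, ⟨hF, hp, -⟩, hN⟩ := h
  have := D.completeSpace_M
  exact ⟨D, ⟨((isFredholm_iff _).1 hF).1, hp⟩, hN⟩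

theorem IsGzBrowder.isLowerSemiGzBrowder (h : IsGzBrowder T) : IsLowerSemiGzBrowder T := by
  obtain ⟨D, ⟨hF, -, hq⟩, hN⟩ := h
  have := D.completeSpace_M
  exact ⟨D, ⟨((isFredholm_iff _).1 hF).2, hq⟩, hN⟩

theorem IsUpperSemiGzBrowder.isUpperSemiGzWeyl (h : IsUpperSemiGzBrowder T) :
    IsUpperSemiGzWeyl T := by
  have hT := h.hasSVEPAt
  obtain ⟨D, hM, hN⟩ := h
  exact ⟨⟨D, hM.1, hN⟩, gzIndex_nonpos ⟨D, Or.inl hM.1, hN⟩ hT⟩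

theorem IsLowerSemiGzBrowder.isLowerSemiGzWeyl (h : IsLowerSemiGzBrowder T) :
    IsLowerSemiGzWeyl T := by
  have hT := h.hasSVEPAt_dualOp
  obtain ⟨D, hM, hN⟩ := h
  exact ⟨⟨D, hM.1, hN⟩, gzIndex_nonneg ⟨D, Or.inr hM.1, hN⟩ hT⟩

theorem IsGzBrowder.isGzWeyl (h : IsGzBrowder T) : IsGzWeyl T := by
  have hindex : gzIndex T = 0 := le_antisymm h.isUpperSemiGzBrowder.isUpperSemiGzWeyl.2
    h.isLowerSemiGzBrowder.isLowerSemiGzWeyl.2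
  obtain ⟨D, hM, hN⟩ := h
  exact ⟨⟨D, hM.1, hN⟩, hindex⟩

theorem IsUpperSemiGzFredholm.isUpperSemiGzBrowder (h : IsUpperSemiGzFredholm T)
    (hT : HasSVEPAt T 0) : IsUpperSemiGzBrowder T := by
  obtain ⟨D, hM, hN⟩ := h
  have := D.completeSpace_M
  have hdescent := IsSemiFredholm.hasTopologicalUniformDescent (Or.inl hM)
  exact ⟨D, ⟨hM, hdescent.ascent_lt_top (D.hasSVEPAt_iff.1 hT).1⟩, hN⟩

theorem IsLowerSemiGzFredholm.isLowerSemiGzBrowder (h : IsLowerSemiGzFredholm T)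
    (hT : HasSVEPAt (dualOp T) 0) : IsLowerSemiGzBrowder T := by
  obtain ⟨D, hM, hN⟩ := h
  have := D.completeSpace_M
  have hdescent := IsSemiFredholm.hasTopologicalUniformDescent (Or.inr hM)
  exact ⟨D, ⟨hM, hdescent.descent_lt_top (D.hasSVEPAt_dualOp_iff.1 hT).1⟩, hN⟩

theorem IsGzFredholm.isGzBrowder (h : IsGzFredholm T) (hT : HasSVEPAt T 0)
    (hT' : HasSVEPAt (dualOp T) 0) : IsGzBrowder T := by
  obtain ⟨D, hM, hN⟩ := h
  have := D.completeSpace_M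
  have hdescent := IsSemiFredholm.hasTopologicalUniformDescent (Or.inl ((isFredholm_iff _).1 hM).1)
  exact ⟨D, ⟨hM, hdescent.ascent_lt_top (D.hasSVEPAt_iff.1 hT).1,
    hdescent.descent_lt_top (D.hasSVEPAt_dualOp_iff.1 hT').1⟩, hN⟩

theorem IsGzWeyl.isGzBrowder (h : IsGzWeyl T) (hT : HasSVEPAt T 0 ∨ HasSVEPAt (dualOp T) 0) :
    IsGzBrowder T := by
  obtain ⟨⟨D₀, hM₀, hN₀⟩, hzero⟩ := h
  have := D₀.completeSpace_M
  obtain ⟨D, hM, hN, hindex⟩ :=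
    exists_gzIndex_eq ⟨D₀, Or.inl ((isFredholm_iff _).1 hM₀).1, hN₀⟩
  have := D.completeSpace_M
  exact ⟨D, hM.isBrowder_of_index_eq_zero (hindex.symm.trans hzero)
    (hT.imp (D.hasSVEPAt_iff.1 · |>.1) (D.hasSVEPAt_dualOp_iff.1 · |>.1)), hN⟩

end GzReduction

end GzTheory

end

theorem proposition3p10 {X : Type*} [NormedAddCommGroup X] [NormedSpace ℂ X] [CompleteSpace X]
    (T : X →L[ℂ] X) :
    [GzTheory.IsUpperSemiGzBrowder T,
      GzTheory.IsUpperSemiGzWeyl T ∧ GzTheory.HasSVEPAt T 0,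
      GzTheory.IsUpperSemiGzFredholm T ∧ GzTheory.HasSVEPAt T 0].TFAE ∧
    [GzTheory.IsLowerSemiGzBrowder T,
      GzTheory.IsLowerSemiGzWeyl T ∧ GzTheory.HasSVEPAt (GzTheory.dualOp T) 0,
      GzTheory.IsLowerSemiGzFredholm T ∧ GzTheory.HasSVEPAt (GzTheory.dualOp T) 0].TFAE ∧
    [GzTheory.IsGzBrowder T,
      GzTheory.IsGzWeyl T ∧
        (GzTheory.HasSVEPAt T 0 ∨ GzTheory.HasSVEPAt (GzTheory.dualOp T) 0),
      GzTheory.IsGzFredholm T ∧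
        GzTheory.HasSVEPAt (T.prodMap (GzTheory.dualOp T)) 0].TFAE := by
  refine ⟨?_, ?_, ?_⟩
  · tfae_have 1 → 2 := fun h => ⟨h.isUpperSemiGzWeyl, h.hasSVEPAt⟩
    tfae_have 2 → 3 := fun h => ⟨h.1.1, h.2⟩
    tfae_have 3 → 1 := fun h => h.1.isUpperSemiGzBrowder h.2
    tfae_finish
  · tfae_have 1 → 2 := fun h => ⟨h.isLowerSemiGzWeyl, h.hasSVEPAt_dualOp⟩
    tfae_have 2 → 3 := fun h => ⟨h.1.1, h.2⟩
    tfae_have 3 → 1 := fun h => h.1.isLowerSemiGzBrowder h.2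
    tfae_finish
  · tfae_have 1 → 2 := fun h => ⟨h.isGzWeyl, Or.inl h.isUpperSemiGzBrowder.hasSVEPAt⟩
    tfae_have 2 → 1 := fun h => h.1.isGzBrowder h.2
    tfae_have 1 → 3 := fun h => ⟨h.isGzWeyl.1, GzTheory.hasSVEPAt_prodMap_iff.2
      ⟨h.isUpperSemiGzBrowder.hasSVEPAt, h.isLowerSemiGzBrowder.hasSVEPAt_dualOp⟩⟩
    tfae_have 3 → 1 := fun h => by
      obtain ⟨h1, h2⟩ := GzTheory.hasSVEPAt_prodMap_iff.1 h.2
      exact h.1.isGzBrowder h1 h2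
    tfae_finish
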